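/- Let $1\le k\le d$ be integers, let $n\ge 0$ be real, and let $\mathbb{T}^d=\mathbb{R}^d/\mathbb{Z}^d$ carry its uniform probability measure and the metric $\rho(x,y)=\min\{\|v\| : v\in\mathbb{R}^d,\ v \text{ represents } x-y\}$. Let $\mathcal{P}_n=\{X_1,\dots,X_N\}$ be the homogeneous Poisson process on $\mathbb{T}^d$ with intensity $n$: $X_1,X_2,\dots$ are i.i.d. uniform on $\mathbb{T}^d$, and $N\sim\mathrm{Poisson}(n)$ is independent of $(X_i)_i$. Let $\rho_n(x)=\min_{p\in\mathcal{P}_n}\rho(x,p)$. A point $c\in\mathbb{T}^d$ is a critical point of index $k$ of $\rho_n$ if there is a set $\mathcal{Y}\subset\mathcal{P}_n$ of $k+1$ points such that (i) $\rho(c,y)=\rho_n(c)$ for all $y\in\mathcal{Y}$ and $\rho(c,p)>\rho_n(c)$ for all $p\in\mathcal{P}_n\setminus\mathcal{Y}$, and (ii) the points $y\in\mathcal{Y}$ have representatives $c+v_y$ with $v_y\in\mathbb{R}^d$, $\|v_y\|=\rho(c,y)$, such that the $k+1$ vectors $v_y$ are affinely independent and $0$ lies in the open $k$-simplex that they span.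 Let $C_k(r)$ be the number of critical points $c$ of index $k$ with $\rho_n(c)\le r$. Let $\omega_d$ be the volume of the unit ball of $\mathbb{R}^d$, $\Lambda=\omega_d n r^d$, and $r_{\max}=\tfrac13\cdot\tfrac12=\tfrac16$. For $y=(y_1,\dots,y_k)\in(\mathbb{R}^d)^k$ with $0,y_1,\dots,y_k$ affinely independent, let $C(0,y)$ and $R(0,y)$ be the centre and the radius of the unique $(k-1)$-sphere through $0,y_1,\dots,y_k$ (that is, their circumsphere within the $k$-dimensional subspace they span), and let $h(0,y)=1$ if $C(0,y)$ lies in the open simplex spanned by $0,y_1,\dots,y_k$, and $h(0,y)=0$ otherwise. Let $\sigma$ be the angular part of Lebesgue measure in the spherical coordinates $y=\tau u$, $\tau=R(0,y)$: the measure on $\{u : R(0,u)=1\}$ with $dy=\tau^{dk-1}\,d\tau\,d\sigma(u)$, i.e. $\sigma(A)=dk\cdot\mathrm{vol}\{\tau u : u\in A,\ 0<\tau\le 1\}$. Put $$\tilde D_k=\frac{1}{\omega_d^k\,(k+1)!}\int h(0,u)\,d\sigma(u),\qquad D_k=\frac{\tilde D_k\,(k-1)!}{d},$$ which depend only on $k$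 and $d$. Then for every $0\le r\le r_{\max}$, $C_k(r)$ is (almost everywhere equal to) a random variable and $$\mathbb{E}[C_k(r)] = D_k\, n\left(1-e^{-\Lambda}\sum_{j=0}^{k-1}\frac{\Lambda^j}{j!}\right).$$ -/

import Mathlib

open MeasureTheory ProbabilityTheory
open scoped NNReal ENNReal Nat

noncomputable section

/-- The projection `ℝ^d → 𝕋^d = ℝ^d / ℤ^d`. -/
def torusProj {d : ℕ} (v : EuclideanSpace ℝ (Fin d)) : UnitAddTorus (Fin d) :=
  fun i => (v i : UnitAddCircle)

/-- The toroidal metric: the least Euclidean norm of a representative in `ℝ^d` of `x - y`. -/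
def torusDist {d : ℕ} (x y : UnitAddTorus (Fin d)) : ℝ :=
  sInf {s : ℝ | ∃ v : EuclideanSpace ℝ (Fin d), torusProj v = x - y ∧ ‖v‖ = s}

/-- The distance function `x ↦ min_{p ∈ P} ρ(x, p)` of a (finite, non-empty) set `P ⊆ 𝕋^d`. -/
def distFun {d : ℕ} (P : Set (UnitAddTorus (Fin d))) (x : UnitAddTorus (Fin d)) : ℝ :=
  sInf ((fun p => torusDist x p) '' P)

/-- `c` is a critical point of index `k ≥ 1` of the distance function of `P`: it is generated by a
set `Y ⊆ P` of `k + 1` points such that all points of `Y` realize the distance from `c` to `P`,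
all other points of `P` are strictly farther away, and, in the flat coordinates centred at `c`
(`v ↦ c + v`, an isometry near `0`), the points of `Y` are the vertices of a non-degenerate
`k`-simplex whose relative interior contains the point `0` that represents `c`. -/
def IsCriticalPoint {d : ℕ} (P : Set (UnitAddTorus (Fin d))) (k : ℕ)
    (c : UnitAddTorus (Fin d)) : Prop :=
  ∃ Y : Finset (UnitAddTorus (Fin d)), (Y : Set (UnitAddTorus (Fin d))) ⊆ P ∧ Y.card = k + 1 ∧
    (∀ y ∈ Y, torusDist c y = distFun P c) ∧
    (∀ p ∈ P, p ∉ Y → distFun P c < torusDist c p) ∧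
    ∃ s : Affine.Simplex ℝ (EuclideanSpace ℝ (Fin d)) k,
      Set.range (fun i => c + torusProj (s.points i)) = (Y : Set (UnitAddTorus (Fin d))) ∧
      (∀ i, ‖s.points i‖ = torusDist c (c + torusProj (s.points i))) ∧
      (0 : EuclideanSpace ℝ (Fin d)) ∈ s.interior

/-- `C_k(r)`: the number of critical points of index `k` with value at most `r`. -/
def numCritical {d : ℕ} (P : Set (UnitAddTorus (Fin d))) (k : ℕ) (r : ℝ) : ℕ∞ :=
  {c : UnitAddTorus (Fin d) | IsCriticalPoint P k c ∧ distFun P c ≤ r}.encard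

/-- The data of a homogeneous Poisson process of intensity `n` on `𝕋^d`: i.i.d. uniform points
`X 0, X 1, …` and an independent Poisson variable `N` with mean `n`. -/
structure IsPoissonData {Ω : Type*} [MeasurableSpace Ω] (μ : Measure Ω) (d : ℕ) (n : ℝ≥0)
    (N : Ω → ℕ) (X : ℕ → Ω → UnitAddTorus (Fin d)) : Prop where
  measurable_points : ∀ i, Measurable (X i)
  measurable_number : Measurable N
  uniform : ∀ i, μ.map (X i) = volume
  indep : iIndepFun X μ
  poisson : μ.map N = poissonMeasure n
  indep_number : IndepFun N (fun ω i => X i ω) μ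

/-- The Poisson process `𝒫_n = {X_1, …, X_N}` (indices start at `0` here). -/
def poissonPoints {Ω : Type*} {d : ℕ} (N : Ω → ℕ) (X : ℕ → Ω → UnitAddTorus (Fin d)) (ω : Ω) :
    Set (UnitAddTorus (Fin d)) :=
  {p | ∃ i < N ω, X i ω = p}

/-- `ω_d`, the volume of the Euclidean unit ball in `ℝ^d`. -/
def unitBallVolume (d : ℕ) : ℝ :=
  volume.real (Metric.ball (0 : EuclideanSpace ℝ (Fin d)) 1)

/-- `Λ = ω_d n r^d`. -/
def bigLambda (d : ℕ) (n r : ℝ) : ℝ := unitBallVolume d * n * r ^ d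

/-- `r_max`, a third of the convexity radius `1 / 2` of `𝕋^d`. -/
def rMax : ℝ := (1 / 2) / 3

/-- The tuple `(0, y_1, …, y_k)`. -/
def withZero {k d : ℕ} (y : Fin k → EuclideanSpace ℝ (Fin d)) :
    Fin (k + 1) → EuclideanSpace ℝ (Fin d) :=
  Fin.cons 0 y

/-- `R(x)`: the radius of the unique `(k-1)`-sphere through the `k + 1` points of a tuple in
general position (and `0` otherwise). -/
def tupleRadius {k d : ℕ} (x : Fin (k + 1) → EuclideanSpace ℝ (Fin d)) : ℝ :=
  open Classical in
  if hx : AffineIndependent ℝ x then (⟨x, hx⟩ : Affine.Simplex ℝ _ k).circumradius else 0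

/-- The event `h(x) = 1`: the tuple is in general position and the centre `C(x)` of the unique
`(k-1)`-sphere through it lies in the open simplex `Δ(x)`. -/
def CenterInSimplex {k d : ℕ} (x : Fin (k + 1) → EuclideanSpace ℝ (Fin d)) : Prop :=
  ∃ hx : AffineIndependent ℝ x,
    (⟨x, hx⟩ : Affine.Simplex ℝ _ k).circumcenter ∈ (⟨x, hx⟩ : Affine.Simplex ℝ _ k).interior

/-- The angular part of Lebesgue measure on `(ℝ^d)^k` in spherical coordinates `y = τ • u`, where
`τ = R(0, y)` and `R(0, u) = 1`: the measure `σ` on `{u | R(0, u) = 1}` such that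
`dy = τ ^ (d k - 1) dτ dσ(u)`, that is, `σ(A) = d k · vol {τ • u | u ∈ A, 0 < τ ≤ 1}`.
If `u_i = θ + γ_i`, where `θ` is the centre, a unit vector, and the `γ_i` are unit vectors in a
`k`-dimensional subspace `γ` containing `θ`, then `σ` is `J(1, θ, γ, (γ_i)) dθ dγ dγ_1 … dγ_k`,
where `J` is the Jacobian of `y` with respect to `(τ, θ, γ, (γ_i))`. -/
def angularMeasure (k d : ℕ) : Measure (Fin k → EuclideanSpace ℝ (Fin d)) :=
  ((d * k : ℕ) : ℝ≥0∞) •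
    (volume.restrict {y : Fin k → EuclideanSpace ℝ (Fin d) |
      AffineIndependent ℝ (withZero y) ∧ tupleRadius (withZero y) ≤ 1}).map
      (fun y => (tupleRadius (withZero y))⁻¹ • y)

/-- `D̃_k = (ω_d^k (k+1)!)⁻¹ ∫ h(0, u) dσ(u)`. -/
def tildeConst (k d : ℕ) : ℝ :=
  1 / (unitBallVolume d ^ k * ((k + 1)! : ℝ)) *
    (angularMeasure k d).real {u | CenterInSimplex (withZero u)}

/-- `D_k = D̃_k (k-1)! / d`, for `1 ≤ k ≤ d`. -/
def critConst (k d : ℕ) : ℝ := tildeConst k d * ((k - 1)! : ℝ) / d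

end

/-! Almost surely the points are distinct. A critical point of value at most `r` is then the same
thing as a set `S` of `k + 1` indices whose points have their circumcentre in their open simplex,
circumradius `R ≤ r`, and no other point in the closed circumball (`numCritical_eq_card`). The bound
`r ≤ 1/6` makes this a Euclidean condition: edges have length at most `2r ≤ 1/3 < 1/2`, so each has
a unique short lift to `ℝ^d`, and the circumball has its Euclidean volume `ω_d R^d`.

For exactly `M` points, independence and Fubini give the mean number of such `S` as `M.choose (k +
1)` times the integral of `(1 - ω_d R^d)^(M - k - 1)` over admissible tuples. Averaging over the
Poisson variable turns this into the integral of `n^(k+1)/(k+1)! * exp(-n ω_d R^d)`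
(`lintegral_numCritical`).

The integrand depends only on edge vectors, so translation invariance reduces it to an integral over
`(ℝ^d)^k` (`lintegral_centeredTuples`). There `h` is scale invariant and `R` is homogeneous of
degree one; hence `R` has density proportional to `τ^(dk-1)` (`map_norm_zeroCenter`). What remains
is an incomplete gamma integral in `Λ`, with an explicit antiderivative
(`lintegral_centeredVectors`). The same homogeneity expresses `D_k` through the volume of `{h = 1, R
≤ 1}` (`critConst_eq`). -/

/-! ### The circumcentre through the Gram matrix -/

/-- The barycentric weights of `y` in the point of the span of `y` that is equidistant from `0` and
all the `y i`. -/
noncomputable def centerWeights {k d : ℕ} (y : Fin k → EuclideanSpace ℝ (Fin d)) : Fin k → ℝ :=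
  Matrix.mulVec (Matrix.gram ℝ y)⁻¹ (fun j => ‖y j‖ ^ 2 / 2)

/-- The barycentric weights of the circumcentre of `(0, y_1, …, y_k)`. -/
noncomputable def fullWeights {k d : ℕ} (y : Fin k → EuclideanSpace ℝ (Fin d)) :
    Fin (k + 1) → ℝ :=
  Fin.cons (1 - ∑ i, centerWeights y i) (centerWeights y)

/-- The circumcentre of `(0, y_1, …, y_k)`. -/
noncomputable def zeroCenter {k d : ℕ} (y : Fin k → EuclideanSpace ℝ (Fin d)) :
    EuclideanSpace ℝ (Fin d) :=
  ∑ i, centerWeights y i • y i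

variable {k d : ℕ}

lemma affineIndependent_withZero_iff (y : Fin k → EuclideanSpace ℝ (Fin d)) :
    AffineIndependent ℝ (withZero y) ↔ LinearIndependent ℝ y := by
  rw [affineIndependent_iff_linearIndependent_vsub ℝ _ (0 : Fin (k + 1))]
  have e : y = (fun i : {x : Fin (k + 1) // x ≠ 0} => (withZero y i -ᵥ withZero y 0)) ∘
      (finSuccAboveEquiv (0 : Fin (k + 1))) := by
    funext i
    simp [withZero, finSuccAboveEquiv_apply]
  conv_rhs => rw [e]
  exact (linearIndependent_equiv (finSuccAboveEquiv (0 : Fin (k + 1)))).symm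

lemma gram_mulVec_centerWeights {y : Fin k → EuclideanSpace ℝ (Fin d)}
    (hy : LinearIndependent ℝ y) :
    Matrix.mulVec (Matrix.gram ℝ y) (centerWeights y) = fun j => ‖y j‖ ^ 2 / 2 := by
  rw [centerWeights, Matrix.mulVec_mulVec, Matrix.mul_nonsing_inv, Matrix.one_mulVec]
  exact isUnit_iff_ne_zero.2 (Matrix.det_gram_ne_zero_iff_linearIndependent.2 hy)

/-- The equation `⟨y_j, c⟩ = ‖y_j‖² / 2` says that `c` is equidistant from `0` and `y_j`; on the
span of `y` these equations form the Gram system that defines the weights. -/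
lemma inner_zeroCenter {y : Fin k → EuclideanSpace ℝ (Fin d)}
    (hy : LinearIndependent ℝ y) (j : Fin k) :
    inner ℝ (y j) (zeroCenter y) = ‖y j‖ ^ 2 / 2 := by
  rw [← congrFun (gram_mulVec_centerWeights hy) j, zeroCenter, inner_sum, Matrix.mulVec,
    dotProduct]
  simp [inner_smul_right, Matrix.gram_apply, mul_comm]

lemma norm_sub_zeroCenter {y : Fin k → EuclideanSpace ℝ (Fin d)}
    (hy : LinearIndependent ℝ y) (i : Fin (k + 1)) :
    ‖withZero y i - zeroCenter y‖ = ‖zeroCenter y‖ := by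
  refine Fin.cases ?_ (fun j => ?_) i
  · simp [withZero]
  · have h := norm_sub_sq_real (y j) (zeroCenter y)
    rw [inner_zeroCenter hy] at h
    have : ‖y j - zeroCenter y‖ ^ 2 = ‖zeroCenter y‖ ^ 2 := by rw [h]; ring
    simpa [withZero] using (sq_eq_sq₀ (norm_nonneg _) (norm_nonneg _)).1 this

lemma sum_fullWeights (y : Fin k → EuclideanSpace ℝ (Fin d)) : ∑ i, fullWeights y i = 1 := by
  simp [fullWeights, Fin.sum_univ_succ]

lemma affineCombination_fullWeights (y : Fin k → EuclideanSpace ℝ (Fin d)) :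
    Finset.univ.affineCombination ℝ (withZero y) (fullWeights y) = zeroCenter y := by
  rw [Finset.affineCombination_eq_linear_combination _ _ _ (sum_fullWeights y)]
  simp [fullWeights, withZero, zeroCenter, Fin.sum_univ_succ]

lemma zeroCenter_mem_affineSpan (y : Fin k → EuclideanSpace ℝ (Fin d)) :
    zeroCenter y ∈ affineSpan ℝ (Set.range (withZero y)) := by
  rw [← affineCombination_fullWeights y]
  exact affineCombination_mem_affineSpan (sum_fullWeights y) _

lemma circumcenter_withZero {y : Fin k → EuclideanSpace ℝ (Fin d)}
    (hy : AffineIndependent ℝ (withZero y)) :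
    (⟨withZero y, hy⟩ : Affine.Simplex ℝ _ k).circumcenter = zeroCenter y :=
  ((⟨withZero y, hy⟩ : Affine.Simplex ℝ _ k).eq_circumcenter_of_dist_eq
    (zeroCenter_mem_affineSpan y) (r := ‖zeroCenter y‖) (fun i => by
      rw [dist_eq_norm]
      exact norm_sub_zeroCenter ((affineIndependent_withZero_iff y).1 hy) i)).symm

lemma tupleRadius_withZero {y : Fin k → EuclideanSpace ℝ (Fin d)}
    (hy : AffineIndependent ℝ (withZero y)) :
    tupleRadius (withZero y) = ‖zeroCenter y‖ := by
  rw [tupleRadius, dif_pos hy]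
  exact ((⟨withZero y, hy⟩ : Affine.Simplex ℝ _ k).eq_circumradius_of_dist_eq
    (zeroCenter_mem_affineSpan y) (r := ‖zeroCenter y‖) (fun i => by
      rw [dist_eq_norm]
      exact norm_sub_zeroCenter ((affineIndependent_withZero_iff y).1 hy) i)).symm

/-- Reduces `h` to finitely many inequalities between explicit functions of `y`, from which
measurability and scale invariance can be read off. -/
lemma centerInSimplex_withZero_iff (y : Fin k → EuclideanSpace ℝ (Fin d)) :
    CenterInSimplex (withZero y) ↔
      LinearIndependent ℝ y ∧ ∀ i, fullWeights y i ∈ Set.Ioo (0 : ℝ) 1 := by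
  rw [CenterInSimplex, ← affineIndependent_withZero_iff]
  refine (exists_congr fun hy => ?_).trans exists_prop
  rw [circumcenter_withZero, ← affineCombination_fullWeights y]
  exact Affine.Simplex.affineCombination_mem_interior_iff (s := ⟨withZero y, hy⟩)
    (sum_fullWeights y)

lemma CenterInSimplex.linearIndependent {y : Fin k → EuclideanSpace ℝ (Fin d)}
    (h : CenterInSimplex (withZero y)) : LinearIndependent ℝ y :=
  ((centerInSimplex_withZero_iff y).1 h).1

/-- Edges from `0` are chords of the circumsphere. This keeps them inside the unit cube when `R ≤
1/6`, and makes `{h = 1, R ≤ 1}` bounded. -/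
lemma CenterInSimplex.norm_le {y : Fin k → EuclideanSpace ℝ (Fin d)}
    (h : CenterInSimplex (withZero y)) (i : Fin k) : ‖y i‖ ≤ 2 * ‖zeroCenter y‖ := by
  have h1 : ‖y i - zeroCenter y‖ = ‖zeroCenter y‖ := by
    simpa [withZero] using norm_sub_zeroCenter h.linearIndependent i.succ
  have h2 := norm_add_le (y i - zeroCenter y) (zeroCenter y)
  rw [sub_add_cancel] at h2
  linarith

lemma gram_smul (τ : ℝ) (y : Fin k → EuclideanSpace ℝ (Fin d)) :
    Matrix.gram ℝ (τ • y) = τ ^ 2 • Matrix.gram ℝ y := by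
  ext i j
  simp [Matrix.gram_apply, inner_smul_left, inner_smul_right]
  ring

lemma linearIndependent_smul_iff {τ : ℝ} (hτ : τ ≠ 0) (y : Fin k → EuclideanSpace ℝ (Fin d)) :
    LinearIndependent ℝ (τ • y) ↔ LinearIndependent ℝ y := by
  rw [← Matrix.det_gram_ne_zero_iff_linearIndependent (𝕜 := ℝ), gram_smul, Matrix.det_smul,
    ← Matrix.det_gram_ne_zero_iff_linearIndependent (𝕜 := ℝ)]
  simp [hτ]

/-- Both the Gram matrix and the right-hand side of the system scale by `τ²`. -/
lemma centerWeights_smul {τ : ℝ} (hτ : τ ≠ 0) {y : Fin k → EuclideanSpace ℝ (Fin d)}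
    (hy : LinearIndependent ℝ y) : centerWeights (τ • y) = centerWeights y := by
  have hdet : IsUnit (Matrix.gram ℝ y).det :=
    isUnit_iff_ne_zero.2 (Matrix.det_gram_ne_zero_iff_linearIndependent.2 hy)
  have hu : IsUnit (τ ^ 2) := (pow_ne_zero 2 hτ).isUnit
  have h1 : (τ ^ 2 • Matrix.gram ℝ y)⁻¹ = (τ ^ 2)⁻¹ • (Matrix.gram ℝ y)⁻¹ := by
    apply Matrix.inv_eq_left_inv
    rw [Matrix.smul_mul, Matrix.mul_smul, smul_smul, inv_mul_cancel₀ (pow_ne_zero 2 hτ), one_smul,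
      Matrix.nonsing_inv_mul _ hdet]
  have h2 : (fun j => ‖(τ • y) j‖ ^ 2 / 2) = τ ^ 2 • fun j => ‖y j‖ ^ 2 / 2 := by
    funext j
    simp [norm_smul, mul_pow, mul_div_assoc]
  rw [centerWeights, gram_smul, h1, h2, Matrix.smul_mulVec, Matrix.mulVec_smul, smul_smul,
    inv_mul_cancel₀ (pow_ne_zero 2 hτ), one_smul, centerWeights]

lemma zeroCenter_smul {τ : ℝ} (hτ : τ ≠ 0) {y : Fin k → EuclideanSpace ℝ (Fin d)}
    (hy : LinearIndependent ℝ y) : zeroCenter (τ • y) = τ • zeroCenter y := by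
  simp only [zeroCenter, centerWeights_smul hτ hy, Pi.smul_apply, Finset.smul_sum]
  exact Finset.sum_congr rfl fun i _ => smul_comm _ _ _

lemma centerInSimplex_smul_iff {τ : ℝ} (hτ : τ ≠ 0) (y : Fin k → EuclideanSpace ℝ (Fin d)) :
    CenterInSimplex (withZero (τ • y)) ↔ CenterInSimplex (withZero y) := by
  rw [centerInSimplex_withZero_iff, centerInSimplex_withZero_iff, linearIndependent_smul_iff hτ]
  refine and_congr_right fun hy => ?_
  rw [fullWeights, centerWeights_smul hτ hy, fullWeights]

lemma zeroCenter_ne_zero [NeZero k] {y : Fin k → EuclideanSpace ℝ (Fin d)}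
    (hy : LinearIndependent ℝ y) : zeroCenter y ≠ 0 := by
  intro h
  have h1 := inner_zeroCenter hy 0
  rw [h, inner_zero_right] at h1
  exact hy.ne_zero 0 (by simpa using h1.symm)

-- The inverse is the adjugate divided by the determinant, so the weights are quotients of
-- continuous functions; a zero determinant only yields the default value `0`.
@[fun_prop]
lemma measurable_centerWeights :
    Measurable (centerWeights : (Fin k → EuclideanSpace ℝ (Fin d)) → Fin k → ℝ) := by
  have hg : Continuous (fun y : Fin k → EuclideanSpace ℝ (Fin d) => Matrix.gram ℝ y) := by
    refine continuous_matrix fun i j => ?_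
    simp only [Matrix.gram_apply]
    fun_prop
  have hd : Measurable (fun y : Fin k → EuclideanSpace ℝ (Fin d) => (Matrix.gram ℝ y).det) :=
    hg.matrix_det.measurable
  have ha : ∀ i j, Measurable
      (fun y : Fin k → EuclideanSpace ℝ (Fin d) => (Matrix.gram ℝ y).adjugate i j) :=
    fun i j => (hg.matrix_adjugate.matrix_elem i j).measurable
  refine measurable_pi_iff.2 fun i => ?_
  simp only [centerWeights, Matrix.mulVec, dotProduct, Matrix.inv_def, Ring.inverse_eq_inv',
    Matrix.smul_apply, smul_eq_mul]
  fun_prop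

@[fun_prop]
lemma measurable_zeroCenter :
    Measurable (zeroCenter : (Fin k → EuclideanSpace ℝ (Fin d)) → _) := by
  unfold zeroCenter
  fun_prop

lemma measurable_fullWeights (i : Fin (k + 1)) :
    Measurable (fun y : Fin k → EuclideanSpace ℝ (Fin d) => fullWeights y i) := by
  refine Fin.cases ?_ (fun j => ?_) i <;> simp only [fullWeights, Fin.cons_zero, Fin.cons_succ] <;>
    fun_prop

lemma measurableSet_linearIndependent :
    MeasurableSet {y : Fin k → EuclideanSpace ℝ (Fin d) | LinearIndependent ℝ y} := by
  have hg : Continuous (fun y : Fin k → EuclideanSpace ℝ (Fin d) => Matrix.gram ℝ y) := by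
    refine continuous_matrix fun i j => ?_
    simp only [Matrix.gram_apply]
    fun_prop
  have hd : Measurable (fun y : Fin k → EuclideanSpace ℝ (Fin d) => (Matrix.gram ℝ y).det) :=
    hg.matrix_det.measurable
  simp_rw [← Matrix.det_gram_ne_zero_iff_linearIndependent (𝕜 := ℝ)]
  exact (measurableSet_eq_fun hd measurable_const).compl

lemma measurableSet_centerInSimplex :
    MeasurableSet {y : Fin k → EuclideanSpace ℝ (Fin d) | CenterInSimplex (withZero y)} := by
  simp_rw [centerInSimplex_withZero_iff]
  exact measurableSet_linearIndependent.inter <| measurableSet_setOfPred.2 <|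
    Measurable.forall fun i => (measurable_fullWeights i measurableSet_Ioo).mem

/-! ### Short lifts and volume on the torus -/

instance : IsProbabilityMeasure (volume : Measure UnitAddCircle) :=
  ⟨by simp [UnitAddCircle]⟩

instance (d : ℕ) : IsProbabilityMeasure (volume : Measure (UnitAddTorus (Fin d))) :=
  inferInstanceAs (IsProbabilityMeasure (Measure.pi _))

instance (d : ℕ) : (volume : Measure (UnitAddTorus (Fin d))).IsAddLeftInvariant :=
  Measure.pi.isAddLeftInvariant _

instance (d : ℕ) : (volume : Measure (UnitAddTorus (Fin d))).IsNegInvariant :=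
  Measure.pi.isNegInvariant _

instance (d : ℕ) : (volume : Measure (UnitAddTorus (Fin d))).IsAddHaarMeasure :=
  Measure.pi.isAddHaarMeasure _

/-- The representative with coordinates in `(-1/2, 1/2]` of a point of the torus. -/
noncomputable def torusLift (x : UnitAddTorus (Fin d)) : EuclideanSpace ℝ (Fin d) :=
  WithLp.toLp 2 fun i => (AddCircle.equivIoc 1 (-1 / 2) (x i) : ℝ)

/-- The cube `(-1/2, 1/2]^d`. -/
def unitCube (d : ℕ) : Set (EuclideanSpace ℝ (Fin d)) :=
  {v | ∀ i, v i ∈ Set.Ioc (-1 / 2 : ℝ) (-1 / 2 + 1)}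

lemma torusProj_sub (v w : EuclideanSpace ℝ (Fin d)) :
    torusProj (v - w) = torusProj v - torusProj w := by
  funext i; simp [torusProj]

lemma torusProj_neg (v : EuclideanSpace ℝ (Fin d)) : torusProj (-v) = -torusProj v := by
  funext i; simp [torusProj]

lemma torusProj_zero : torusProj (0 : EuclideanSpace ℝ (Fin d)) = 0 := by
  funext i; simp [torusProj]

lemma torusProj_torusLift (x : UnitAddTorus (Fin d)) : torusProj (torusLift x) = x := by
  funext i
  exact AddCircle.coe_equivIoc

lemma torusLift_mem_unitCube (x : UnitAddTorus (Fin d)) : torusLift x ∈ unitCube d :=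
  fun i => (AddCircle.equivIoc 1 (-1 / 2) (x i)).2

lemma torusLift_torusProj {v : EuclideanSpace ℝ (Fin d)} (hv : v ∈ unitCube d) :
    torusLift (torusProj v) = v := by
  ext i
  exact AddCircle.equivIoc_coe_of_mem (hv i)

lemma mem_unitCube_of_norm_lt {v : EuclideanSpace ℝ (Fin d)} (hv : ‖v‖ < 1 / 2) :
    v ∈ unitCube d := by
  intro i
  have h := abs_lt.1 ((Real.norm_eq_abs _ ▸ PiLp.norm_apply_le v i).trans_lt hv)
  exact ⟨by linarith [h.1], by linarith [h.2]⟩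

/-- Coordinatewise, representatives differ by integers, and the one in `(-1/2, 1/2]` has least
absolute value. -/
lemma norm_torusLift_le {x : UnitAddTorus (Fin d)} {v : EuclideanSpace ℝ (Fin d)}
    (hv : torusProj v = x) : ‖torusLift x‖ ≤ ‖v‖ := by
  rw [EuclideanSpace.norm_eq, EuclideanSpace.norm_eq]
  refine Real.sqrt_le_sqrt (Finset.sum_le_sum fun i _ => ?_)
  refine pow_le_pow_left₀ (norm_nonneg _) ?_ 2
  have h1 := torusLift_mem_unitCube x i
  have h2 : ((v i : ℝ) : UnitAddCircle) = (torusLift x i : ℝ) := by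
    have := (congrFun hv i).trans (congrFun (torusProj_torusLift x) i).symm
    exact this
  obtain ⟨m, hm⟩ := (AddCircle.coe_eq_zero_iff (1 : ℝ) (x := v i - torusLift x i)).1
    (by rw [AddCircle.coe_sub, h2, sub_self])
  rw [zsmul_eq_mul, mul_one] at hm
  rw [Real.norm_eq_abs, Real.norm_eq_abs]
  obtain ⟨h3, h4⟩ := h1
  rcases lt_trichotomy m 0 with h | rfl | h
  · have : (m : ℝ) ≤ -1 := by exact_mod_cast Int.le_sub_one_of_lt h
    rw [abs_of_nonpos (show v i ≤ 0 by linarith)]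
    exact abs_le.2 ⟨by linarith, by linarith⟩
  · rw [Int.cast_zero] at hm
    rw [show v i = torusLift x i by linarith]
  · have : (1 : ℝ) ≤ m := by exact_mod_cast h
    refine le_trans ?_ (le_abs_self _)
    exact abs_le.2 ⟨by linarith, by linarith⟩

lemma torusDist_eq (x y : UnitAddTorus (Fin d)) : torusDist x y = ‖torusLift (x - y)‖ := by
  refine IsLeast.csInf_eq ⟨⟨_, torusProj_torusLift _, rfl⟩, ?_⟩
  rintro s ⟨v, hv, rfl⟩
  exact norm_torusLift_le hv

lemma torusDist_add_torusProj (c : UnitAddTorus (Fin d)) {v : EuclideanSpace ℝ (Fin d)}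
    (hv : ‖v‖ < 1 / 2) : torusDist c (c + torusProj v) = ‖v‖ := by
  rw [torusDist_eq, sub_add_cancel_left, ← torusProj_neg, torusLift_torusProj, norm_neg]
  exact mem_unitCube_of_norm_lt (by rwa [norm_neg])

@[fun_prop]
lemma measurable_torusProj : Measurable (torusProj (d := d)) := by
  unfold torusProj
  exact measurable_pi_iff.2 fun i => AddCircle.measurable_mk'.comp (by fun_prop)

@[fun_prop]
lemma measurable_torusLift : Measurable (torusLift (d := d)) := by
  unfold torusLift
  refine (WithLp.measurable_toLp 2 _).comp (measurable_pi_iff.2 fun i => ?_)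
  exact measurable_subtype_coe.comp
    ((AddCircle.measurableEquivIoc 1 (-1 / 2)).measurable.comp (measurable_pi_apply i))

lemma unitCube_eq : unitCube d = WithLp.ofLp ⁻¹'
    (Set.univ.pi fun _ => Set.Ioc (-1 / 2 : ℝ) (-1 / 2 + 1)) := by
  ext v; simp [unitCube]

lemma measurableSet_unitCube : MeasurableSet (unitCube d) := by
  rw [unitCube_eq]
  exact (WithLp.measurable_ofLp 2 _) (MeasurableSet.univ_pi fun _ => measurableSet_Ioc)

lemma map_torusProj : (volume.restrict (unitCube d)).map torusProj = volume := by
  have h1 : MeasurePreserving (WithLp.ofLp : EuclideanSpace ℝ (Fin d) → Fin d → ℝ)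
      (volume.restrict (unitCube d))
      (volume.restrict (Set.univ.pi fun _ => Set.Ioc (-1 / 2 : ℝ) (-1 / 2 + 1))) := by
    rw [unitCube_eq]
    exact (PiLp.volume_preserving_ofLp (Fin d)).restrict_preimage
      (MeasurableSet.univ_pi fun _ => measurableSet_Ioc)
  have h2 := measurePreserving_pi
    (fun _ : Fin d => volume.restrict (Set.Ioc (-1 / 2 : ℝ) (-1 / 2 + 1)))
    (fun _ => (volume : Measure UnitAddCircle))
    (fun _ => AddCircle.measurePreserving_mk 1 (-1 / 2 : ℝ))
  rw [← Measure.restrict_pi_pi] at h2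
  exact (h2.comp h1).map_eq

lemma map_torusLift :
    (volume : Measure (UnitAddTorus (Fin d))).map torusLift = volume.restrict (unitCube d) := by
  rw [← map_torusProj, Measure.map_map measurable_torusLift measurable_torusProj]
  conv_rhs => rw [← Measure.map_id (μ := volume.restrict (unitCube d))]
  refine Measure.map_congr ?_
  filter_upwards [ae_restrict_mem measurableSet_unitCube] with v hv
  exact torusLift_torusProj hv

instance (d : ℕ) [NeZero d] :
    NullSingletonClass (volume : Measure (UnitAddTorus (Fin d))) := by
  refine ⟨fun x => ?_⟩
  rw [← map_torusProj, Measure.map_apply measurable_torusProj (measurableSet_singleton x)]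
  refine measure_mono_null (t := {torusLift x} ∪ (unitCube d)ᶜ) ?_ ?_
  · intro v hv
    by_cases h : v ∈ unitCube d
    · exact Or.inl (by rw [← hv, torusLift_torusProj h]; rfl)
    · exact Or.inr h
  · refine measure_union_null (measure_singleton _) ?_
    rw [Measure.restrict_apply measurableSet_unitCube.compl, Set.compl_inter_self, measure_empty]

/-- A Euclidean ball of radius less than `1/2` fits in the fundamental cube, so projecting it to the
torus causes no overlap. -/
lemma volume_torusDist_le (c : UnitAddTorus (Fin d)) {ρ : ℝ} (h0 : 0 ≤ ρ) (hρ : ρ < 1 / 2) :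
    volume {x | torusDist c x ≤ ρ} = ENNReal.ofReal (unitBallVolume d * ρ ^ d) := by
  have h1 : {x | torusDist c x ≤ ρ} =
      (fun x => c - x) ⁻¹' (torusLift ⁻¹' Metric.closedBall 0 ρ) := by
    ext x; simp [torusDist_eq]
  rw [h1, (Measure.measurePreserving_sub_left volume c).measure_preimage
    (measurable_torusLift measurableSet_closedBall).nullMeasurableSet,
    ← Measure.map_apply measurable_torusLift measurableSet_closedBall, map_torusLift,
    Measure.restrict_apply measurableSet_closedBall, Set.inter_eq_left.2,
    Measure.addHaar_closedBall _ _ h0, unitBallVolume, mul_comm, ENNReal.ofReal_mul (by positivity)]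
  · rw [finrank_euclideanSpace_fin, Measure.real, ENNReal.ofReal_toReal measure_ball_lt_top.ne,
      mul_comm]
  · intro v hv
    exact mem_unitCube_of_norm_lt ((mem_closedBall_zero_iff.1 hv).trans_lt hρ)

/-! ### Critical points as sets of indices -/

/-- The edge vectors from the first point of a tuple of points on the torus, as short vectors. -/
noncomputable def edgeLift (t : Fin (k + 1) → UnitAddTorus (Fin d)) :
    Fin k → EuclideanSpace ℝ (Fin d) :=
  fun i => torusLift (t i.succ - t 0)

/-- The circumcentre of a tuple of nearby points on the torus. -/
noncomputable def tupleCenter (t : Fin (k + 1) → UnitAddTorus (Fin d)) : UnitAddTorus (Fin d) :=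
  t 0 + torusProj (zeroCenter (edgeLift t))

@[fun_prop]
lemma measurable_edgeLift : Measurable (edgeLift (k := k) (d := d)) := by
  unfold edgeLift
  fun_prop

@[fun_prop]
lemma measurable_tupleCenter : Measurable (tupleCenter (k := k) (d := d)) := by
  unfold tupleCenter
  fun_prop

lemma torusProj_withZero_edgeLift (t : Fin (k + 1) → UnitAddTorus (Fin d)) (i : Fin (k + 1)) :
    t 0 + torusProj (withZero (edgeLift t) i) = t i := by
  refine Fin.cases ?_ (fun j => ?_) i
  · simp [withZero, torusProj_zero]
  · simp [withZero, edgeLift, torusProj_torusLift]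

/-- The two sides differ by a translation of coordinates: the left has its origin at `c`, the right
at `t 0`. Equidistance then identifies `c` with the circumcentre. -/
lemma exists_simplex_iff (t : Fin (k + 1) → UnitAddTorus (Fin d)) (c : UnitAddTorus (Fin d))
    {ρ : ℝ} (hρ : ρ ≤ 1 / 6) :
    (∃ s : Affine.Simplex ℝ (EuclideanSpace ℝ (Fin d)) k,
      (∀ i, c + torusProj (s.points i) = t i) ∧ (∀ i, ‖s.points i‖ = ρ) ∧
        (0 : EuclideanSpace ℝ (Fin d)) ∈ s.interior) ↔
    CenterInSimplex (withZero (edgeLift t)) ∧ c = tupleCenter t ∧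
      ‖zeroCenter (edgeLift t)‖ = ρ := by
  constructor
  · rintro ⟨s, h1, h2, h3⟩
    let f : EuclideanSpace ℝ (Fin d) →ᵃ[ℝ] EuclideanSpace ℝ (Fin d) :=
      (AffineEquiv.constVAdd ℝ (EuclideanSpace ℝ (Fin d)) (-s.points 0)).toAffineMap
    have hf : ∀ v, f v = v - s.points 0 := fun v => by
      simp [f, sub_eq_neg_add]
    have hinj : Function.Injective f := (AffineEquiv.constVAdd ℝ _ (-s.points 0)).injective
    have hpts : (s.map f hinj).points = withZero (edgeLift t) := by
      funext i
      rw [Affine.Simplex.map_points, Function.comp_apply, hf]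
      refine Fin.cases ?_ (fun j => ?_) i
      · simp [withZero]
      · have : t j.succ - t 0 = torusProj (s.points j.succ - s.points 0) := by
          rw [torusProj_sub, ← h1, ← h1]; abel
        simp only [withZero, Fin.cons_succ, edgeLift, this]
        rw [torusLift_torusProj]
        -- The difference of two vertices has norm at most `2ρ ≤ 1/3`, so it is its own short lift.
        refine mem_unitCube_of_norm_lt ((norm_sub_le _ _).trans_lt ?_)
        rw [h2, h2]; linarith
    have hind : AffineIndependent ℝ (withZero (edgeLift t)) := hpts ▸ (s.map f hinj).independent
    have hs : (⟨withZero (edgeLift t), hind⟩ : Affine.Simplex ℝ _ k) = s.map f hinj :=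
      Affine.Simplex.ext fun i => congrFun hpts.symm i
    have hint : -s.points 0 ∈ (s.map f hinj).interior := by
      rw [Affine.Simplex.interior_map]
      exact ⟨0, h3, by rw [hf, zero_sub]⟩
    have hcc : zeroCenter (edgeLift t) = -s.points 0 := by
      rw [← circumcenter_withZero hind, hs]
      refine ((s.map f hinj).eq_circumcenter_of_dist_eq (r := ρ) ?_ fun i => ?_).symm
      · exact Affine.Simplex.closedInterior_subset_affineSpan
          (Affine.Simplex.interior_subset_closedInterior _ hint)
      · rw [Affine.Simplex.map_points, Function.comp_apply, hf, dist_eq_norm, sub_neg_eq_add,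
          sub_add_cancel, h2]
    refine ⟨⟨hind, ?_⟩, ?_, ?_⟩
    · rw [circumcenter_withZero hind, hcc, hs]
      exact hint
    · rw [tupleCenter, hcc, torusProj_neg, ← h1 0, add_neg_cancel_right]
    · rw [hcc, norm_neg, h2]
  · rintro ⟨⟨hind, hint⟩, rfl, hr⟩
    have hli := (affineIndependent_withZero_iff _).1 hind
    rw [circumcenter_withZero hind] at hint
    set c := zeroCenter (edgeLift t) with hc
    let f : EuclideanSpace ℝ (Fin d) →ᵃ[ℝ] EuclideanSpace ℝ (Fin d) :=
      (AffineEquiv.constVAdd ℝ (EuclideanSpace ℝ (Fin d)) (-c)).toAffineMap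
    have hf : ∀ v, f v = v - c := fun v => by
      simp [f, sub_eq_neg_add]
    have hinj : Function.Injective f := (AffineEquiv.constVAdd ℝ _ (-c)).injective
    refine ⟨(⟨withZero (edgeLift t), hind⟩ : Affine.Simplex ℝ _ k).map f hinj, fun i => ?_,
      fun i => ?_, ?_⟩
    · rw [Affine.Simplex.map_points, Function.comp_apply, hf, torusProj_sub,
        ← torusProj_withZero_edgeLift t i, tupleCenter, ← hc]
      abel
    · rw [Affine.Simplex.map_points, Function.comp_apply, hf, norm_sub_zeroCenter hli, hr]
    · rw [Affine.Simplex.interior_map]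
      exact ⟨c, hint, by rw [hf, sub_self]⟩

/-- The points with indices in `S`, a set of `k + 1` indices, generate a critical point of the
distance function of `{x i | i < M}` of value at most `r`. -/
def Generates (x : ℕ → UnitAddTorus (Fin d)) (M k : ℕ) (r : ℝ) (S : Finset ℕ) : Prop :=
  ∃ h : S.card = k + 1,
    CenterInSimplex (withZero (edgeLift (x ∘ S.orderEmbOfFin h))) ∧
    ‖zeroCenter (edgeLift (x ∘ S.orderEmbOfFin h))‖ ≤ r ∧
    ∀ j ∈ Finset.range M \ S, ‖zeroCenter (edgeLift (x ∘ S.orderEmbOfFin h))‖ <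
      torusDist (tupleCenter (x ∘ S.orderEmbOfFin h)) (x j)

lemma exists_perm_of_range_eq {α : Type*} {n : ℕ} {f g : Fin n → α} (hg : Function.Injective g)
    (h : Set.range f = Set.range g) : ∃ e : Equiv.Perm (Fin n), ∀ i, f (e i) = g i := by
  have h1 : ∀ i, ∃ j, f j = g i := fun i => h.ge (Set.mem_range_self i)
  choose e he using h1
  have hinj : Function.Injective e := fun i j hij => hg (by rw [← he, ← he, hij])
  exact ⟨Equiv.ofBijective e (Finite.injective_iff_bijective.1 hinj), he⟩

/-- The indices of the points that realize the distance to `c`. -/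
noncomputable def nearestIndices (x : ℕ → UnitAddTorus (Fin d)) (M : ℕ)
    (c : UnitAddTorus (Fin d)) : Finset ℕ :=
  open Classical in
  (Finset.range M).filter fun j => torusDist c (x j) = distFun {p | ∃ i < M, x i = p} c

lemma IsCriticalPoint.generates {x : ℕ → UnitAddTorus (Fin d)} {M : ℕ}
    (hx : Set.InjOn x (Set.Iio M)) {r : ℝ} (hr : r ≤ 1 / 6) {c : UnitAddTorus (Fin d)}
    (hc : IsCriticalPoint {p | ∃ i < M, x i = p} k c)
    (hcr : distFun {p | ∃ i < M, x i = p} c ≤ r) :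
    Generates x M k r (nearestIndices x M c) ∧ ∀ h : (nearestIndices x M c).card = k + 1,
      c = tupleCenter (x ∘ (nearestIndices x M c).orderEmbOfFin h) := by
  classical
  obtain ⟨Y, hYP, hYc, hYe, hYl, s, hs, hsn, hs0⟩ := hc
  set S := nearestIndices x M c with hS
  have hSY : ∀ j, j < M → (j ∈ S ↔ x j ∈ Y) := by
    intro j hj
    rw [hS, nearestIndices, Finset.mem_filter, Finset.mem_range]
    refine ⟨fun h => by_contra fun hY => (hYl _ ⟨j, hj, rfl⟩ hY).ne' h.2, fun h => ⟨hj, hYe _ h⟩⟩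
  have hSM : ∀ j ∈ S, j < M := fun j hj => by
    rw [hS, nearestIndices, Finset.mem_filter, Finset.mem_range] at hj
    exact hj.1
  have himg : S.image x = Y := by
    ext y
    rw [Finset.mem_image]
    constructor
    · rintro ⟨j, hj, rfl⟩
      exact (hSY j (hSM j hj)).1 hj
    · intro hy
      obtain ⟨j, hj, rfl⟩ := hYP hy
      exact ⟨j, (hSY j hj).2 hy, rfl⟩
  have hcard : S.card = k + 1 := by
    rw [← hYc, ← himg, Finset.card_image_of_injOn]
    exact fun i hi j hj hij => hx (hSM i hi) (hSM j hj) hij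
  have key : CenterInSimplex (withZero (edgeLift (x ∘ S.orderEmbOfFin hcard))) ∧
      c = tupleCenter (x ∘ S.orderEmbOfFin hcard) ∧
      ‖zeroCenter (edgeLift (x ∘ S.orderEmbOfFin hcard))‖ =
        distFun {p | ∃ i < M, x i = p} c := by
    refine (exists_simplex_iff _ c (hcr.trans hr)).1 ?_
    have hinj : Function.Injective (x ∘ S.orderEmbOfFin hcard) := by
      intro i j hij
      exact (S.orderEmbOfFin hcard).injective (hx (hSM _ (S.orderEmbOfFin_mem hcard i))
        (hSM _ (S.orderEmbOfFin_mem hcard j)) hij)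
    have hrange : Set.range (fun i => c + torusProj (s.points i)) =
        Set.range (x ∘ S.orderEmbOfFin hcard) := by
      rw [hs, Set.range_comp, Finset.range_orderEmbOfFin, ← himg, Finset.coe_image]
    obtain ⟨e, he⟩ := exists_perm_of_range_eq hinj hrange
    -- The simplex lists its vertices in an arbitrary order, whereas `S` is listed increasingly.
    refine ⟨s.reindex e.symm, fun i => ?_, fun i => ?_, ?_⟩
    · rw [← he]; rfl
    · refine (hsn (e i)).trans (hYe _ ?_)
      rw [← Finset.mem_coe, ← hs]
      exact Set.mem_range_self _
    · rwa [Affine.Simplex.interior_reindex]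
  refine ⟨⟨hcard, key.1, key.2.2.le.trans hcr, fun j hj => ?_⟩, fun _ => key.2.1⟩
  rw [Finset.mem_sdiff, Finset.mem_range] at hj
  rw [key.2.2, ← key.2.1]
  exact hYl _ ⟨j, hj.1, rfl⟩ fun h => hj.2 ((hSY j hj.1).2 h)

lemma Generates.exists_critical {x : ℕ → UnitAddTorus (Fin d)} {M : ℕ}
    (hx : Set.InjOn x (Set.Iio M)) {r : ℝ} (hr : r ≤ 1 / 6) {S : Finset ℕ}
    (hS : Generates x M k r S) (hSM : S ⊆ Finset.range M) :
    ∃ c, (IsCriticalPoint {p | ∃ i < M, x i = p} k c ∧ distFun {p | ∃ i < M, x i = p} c ≤ r) ∧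
      nearestIndices x M c = S := by
  classical
  obtain ⟨hcard, h1, h2, h3⟩ := hS
  set t := x ∘ S.orderEmbOfFin hcard with ht
  obtain ⟨s, hs1, hs2, hs3⟩ := (exists_simplex_iff t (tupleCenter t) (h2.trans hr)).2
    ⟨h1, rfl, rfl⟩
  set ρ := ‖zeroCenter (edgeLift t)‖ with hρ
  set c := tupleCenter t with hc
  set P := {p | ∃ i < M, x i = p} with hP
  have hdt : ∀ i, torusDist c (t i) = ρ := fun i => by
    rw [← hs1 i, torusDist_add_torusProj c (by rw [hs2]; linarith), hs2]
  have hdS : ∀ j ∈ S, torusDist c (x j) = ρ := fun j hj => by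
    have : j ∈ Set.range (S.orderEmbOfFin hcard) := by
      rw [Finset.range_orderEmbOfFin]; exact hj
    obtain ⟨i, rfl⟩ := this
    exact hdt i
  have hdist : distFun P c = ρ := by
    refine IsLeast.csInf_eq ⟨⟨t 0, ⟨_, ?_, rfl⟩, hdt 0⟩, ?_⟩
    · exact Finset.mem_range.1 (hSM (S.orderEmbOfFin_mem hcard 0))
    · rintro _ ⟨_, ⟨j, hj, rfl⟩, rfl⟩
      by_cases hjS : j ∈ S
      · exact (hdS j hjS).ge
      · exact (h3 j (Finset.mem_sdiff.2 ⟨Finset.mem_range.2 hj, hjS⟩)).le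
  refine ⟨c, ⟨⟨S.image x, ?_, ?_, ?_, ?_, s, ?_, ?_, hs3⟩, hdist.trans_le h2⟩, ?_⟩
  · rintro _ hy
    obtain ⟨j, hj, rfl⟩ := Finset.mem_image.1 hy
    exact ⟨j, Finset.mem_range.1 (hSM hj), rfl⟩
  · rw [Finset.card_image_of_injOn, hcard]
    exact fun i hi j hj hij =>
      hx (Finset.mem_range.1 (hSM hi)) (Finset.mem_range.1 (hSM hj)) hij
  · intro y hy
    obtain ⟨j, hj, rfl⟩ := Finset.mem_image.1 hy
    rw [hdist, hdS j hj]
  · rintro _ ⟨j, hj, rfl⟩ hY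
    rw [hdist]
    exact h3 j (Finset.mem_sdiff.2 ⟨Finset.mem_range.2 hj,
      fun h => hY (Finset.mem_image_of_mem x h)⟩)
  · rw [show (fun i => c + torusProj (s.points i)) = t from funext hs1, ht, Set.range_comp,
      Finset.range_orderEmbOfFin, Finset.coe_image]
  · intro i
    rw [hs1, hs2, hdt]
  · ext j
    rw [nearestIndices, Finset.mem_filter, Finset.mem_range]
    constructor
    · rintro ⟨hj, hj2⟩
      by_contra hjS
      exact (h3 j (Finset.mem_sdiff.2 ⟨Finset.mem_range.2 hj, hjS⟩)).ne' (hj2.trans hdist)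
    · exact fun hj => ⟨Finset.mem_range.1 (hSM hj), (hdS j hj).trans hdist.symm⟩

/-- The bijection sends `c` to its nearest indices; it is injective because `c` is recovered as the
circumcentre of those points. -/
lemma numCritical_eq_card {x : ℕ → UnitAddTorus (Fin d)} {M : ℕ}
    (hx : Set.InjOn x (Set.Iio M)) {r : ℝ} (hr : r ≤ 1 / 6) :
    open Classical in
    numCritical {p | ∃ i < M, x i = p} k r =
      (((Finset.range M).powersetCard (k + 1)).filter (Generates x M k r)).card := by
  classical
  have hbij : Set.BijOn (nearestIndices x M)
      {c | IsCriticalPoint {p | ∃ i < M, x i = p} k c ∧ distFun {p | ∃ i < M, x i = p} c ≤ r}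
      ↑(((Finset.range M).powersetCard (k + 1)).filter (Generates x M k r)) := by
    refine ⟨fun c hc => ?_, fun c hc c' hc' h => ?_, fun S hS => ?_⟩
    · have h := (hc.1.generates hx hr hc.2).1
      rw [Finset.mem_coe, Finset.mem_filter, Finset.mem_powersetCard]
      exact ⟨⟨Finset.filter_subset _ _, h.1⟩, h⟩
    · obtain ⟨h1, h2⟩ := hc.1.generates hx hr hc.2
      obtain ⟨h1', h2'⟩ := hc'.1.generates hx hr hc'.2
      rw [h2 h1.1, h2' h1'.1]
      congr! 4
    · rw [Finset.mem_coe, Finset.mem_filter, Finset.mem_powersetCard] at hS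
      exact hS.2.exists_critical hx hr hS.1.1
  rw [numCritical, ← hbij.injOn.encard_image, hbij.image_eq, Set.encard_coe_eq_coe_finsetCard]

/-! ### Empty circumballs -/

/-- The tuples that generate a critical point of value at most `r` unless other points are closer to
it. -/
def centeredTuples (k d : ℕ) (r : ℝ) : Set (Fin (k + 1) → UnitAddTorus (Fin d)) :=
  {t | CenterInSimplex (withZero (edgeLift t)) ∧ ‖zeroCenter (edgeLift t)‖ ≤ r}

lemma measurableSet_centeredTuples (r : ℝ) : MeasurableSet (centeredTuples k d r) :=
  (measurable_edgeLift measurableSet_centerInSimplex).inter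
    (measurableSet_le (f := fun t => ‖zeroCenter (edgeLift t)‖) (by fun_prop) measurable_const)

/-- The pairs of a tuple generating a critical point and of a family of points that are not closer
to it. -/
def emptyBallPairs (k d : ℕ) (r : ℝ) (J : Finset ℕ) :
    Set ((Fin (k + 1) → UnitAddTorus (Fin d)) × (J → UnitAddTorus (Fin d))) :=
  {p | p.1 ∈ centeredTuples k d r ∧
    ∀ j, ‖zeroCenter (edgeLift p.1)‖ < torusDist (tupleCenter p.1) (p.2 j)}

lemma measurableSet_emptyBallPairs (r : ℝ) (J : Finset ℕ) :
    MeasurableSet (emptyBallPairs k d r J) := by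
  refine (measurable_fst (measurableSet_centeredTuples r)).inter <|
    measurableSet_setOfPred.2 <| Measurable.forall fun j => measurableSet_setOfPred.1 <|
    measurableSet_lt (by fun_prop) ?_
  simp_rw [torusDist_eq]
  fun_prop

lemma generates_iff {x : ℕ → UnitAddTorus (Fin d)} {M : ℕ} {r : ℝ} {S : Finset ℕ}
    (h : S.card = k + 1) : Generates x M k r S ↔
      ((x ∘ S.orderEmbOfFin h, fun j : (Finset.range M \ S : Finset ℕ) => x j) :
        _ × ((Finset.range M \ S : Finset ℕ) → _)) ∈ emptyBallPairs k d r (Finset.range M \ S) := by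
  simp only [Generates, emptyBallPairs, centeredTuples, Set.mem_ofPred_eq, h, exists_true_left,
    and_assoc, Subtype.forall]

lemma measurableSet_generates (M : ℕ) (r : ℝ) {S : Finset ℕ} (h : S.card = k + 1) :
    MeasurableSet {x : ℕ → UnitAddTorus (Fin d) | Generates x M k r S} := by
  simp_rw [generates_iff h]
  refine (measurableSet_emptyBallPairs r _).preimage ?_
  refine Measurable.prodMk (measurable_pi_iff.2 fun i => measurable_pi_apply _)
    (measurable_pi_iff.2 fun i => measurable_pi_apply _)

lemma volume_lt_torusDist (c : UnitAddTorus (Fin d)) {ρ : ℝ} (h0 : 0 ≤ ρ) (hρ : ρ < 1 / 2) :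
    volume {x | ρ < torusDist c x} = ENNReal.ofReal (1 - unitBallVolume d * ρ ^ d) := by
  have h : {x | ρ < torusDist c x} = {x | torusDist c x ≤ ρ}ᶜ := by ext; simp
  have hm : MeasurableSet {x | torusDist c x ≤ ρ} := by
    simp_rw [torusDist_eq]
    exact measurableSet_le (f := fun x => ‖torusLift (c - x)‖) (by fun_prop) measurable_const
  rw [h, prob_compl_eq_one_sub hm, volume_torusDist_le c h0 hρ,
    ENNReal.ofReal_sub _ (by unfold unitBallVolume; positivity), ENNReal.ofReal_one]

lemma unitBallVolume_mul_pow_le_one (d : ℕ) {ρ : ℝ} (h0 : 0 ≤ ρ) (hρ : ρ < 1 / 2) :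
    unitBallVolume d * ρ ^ d ≤ 1 := by
  rw [← ENNReal.ofReal_le_one, ← volume_torusDist_le 0 h0 hρ]
  exact prob_le_one

/-- By Fubini: for a fixed tuple, each remaining point independently avoids the same closed ball. -/
lemma volume_emptyBallPairs {r : ℝ} (hr : r < 1 / 2) (J : Finset ℕ) :
    (volume.prod volume) (emptyBallPairs k d r J) =
      ∫⁻ t in centeredTuples k d r,
        ENNReal.ofReal (1 - unitBallVolume d * ‖zeroCenter (edgeLift t)‖ ^ d) ^ J.card := by
  rw [Measure.prod_apply (measurableSet_emptyBallPairs r J),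
    ← lintegral_indicator (measurableSet_centeredTuples r)]
  refine lintegral_congr fun t => ?_
  by_cases ht : t ∈ centeredTuples k d r
  · have : Prod.mk t ⁻¹' emptyBallPairs k d r J = Set.univ.pi fun _ =>
        {x | ‖zeroCenter (edgeLift t)‖ < torusDist (tupleCenter t) x} := by
      ext v
      simp [emptyBallPairs, ht]
    rw [Set.indicator_of_mem ht, this, volume_pi_pi]
    simp [volume_lt_torusDist (tupleCenter t) (norm_nonneg _) (ht.2.trans_lt hr)]
  · have : Prod.mk t ⁻¹' emptyBallPairs k d r J = ∅ := by
      ext v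
      simp [emptyBallPairs, ht]
    rw [Set.indicator_of_notMem ht, this, measure_empty]

/-! ### Expectation over the Poisson process -/

section Poisson

variable {Ω : Type*} [MeasurableSpace Ω] {μ : Measure Ω} [IsProbabilityMeasure μ]

lemma map_precomp_eq_volume {X : ℕ → Ω → UnitAddTorus (Fin d)} (hX : ∀ i, Measurable (X i))
    (hu : ∀ i, μ.map (X i) = volume) (hi : iIndepFun X μ) {ι : Type*} [Fintype ι] {g : ι → ℕ}
    (hg : Function.Injective g) : μ.map (fun ω i => X (g i) ω) = volume := by
  rw [(iIndepFun_iff_map_fun_eq_pi_map (f := fun i => X (g i)) fun i => (hX _).aemeasurable).1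
    (hi.precomp hg)]
  simp_rw [hu]
  rfl

lemma measure_generates {X : ℕ → Ω → UnitAddTorus (Fin d)} (hX : ∀ i, Measurable (X i))
    (hu : ∀ i, μ.map (X i) = volume) (hi : iIndepFun X μ) {r : ℝ} (hr : r < 1 / 2) {M : ℕ}
    {S : Finset ℕ} (hS : S ∈ (Finset.range M).powersetCard (k + 1)) :
    μ {ω | Generates (fun i => X i ω) M k r S} =
      ∫⁻ t in centeredTuples k d r,
        ENNReal.ofReal (1 - unitBallVolume d * ‖zeroCenter (edgeLift t)‖ ^ d) ^ (M - (k + 1)) := by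
  obtain ⟨hSM, h⟩ := Finset.mem_powersetCard.1 hS
  set J := Finset.range M \ S with hJ
  have hJc : J.card = M - (k + 1) := by
    rw [hJ, Finset.card_sdiff_of_subset hSM, Finset.card_range, h]
  set U : Ω → Fin (k + 1) → UnitAddTorus (Fin d) := fun ω i => X (S.orderEmbOfFin h i) ω with hU
  set V : Ω → J → UnitAddTorus (Fin d) := fun ω j => X j ω with hV
  have hUm : Measurable U := measurable_pi_iff.2 fun i => hX _
  have hVm : Measurable V := measurable_pi_iff.2 fun i => hX _
  have hind : IndepFun U V μ := by
    have hf : Measurable fun (z : S → UnitAddTorus (Fin d)) (i : Fin (k + 1)) =>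
        z ⟨S.orderEmbOfFin h i, S.orderEmbOfFin_mem h i⟩ :=
      measurable_pi_iff.2 fun i => measurable_pi_apply _
    exact (hi.indepFun_finset S J Finset.disjoint_sdiff hX).comp hf measurable_id
  have hlaw : μ.map (fun ω => (U ω, V ω)) = volume.prod volume := by
    rw [(indepFun_iff_map_prod_eq_prod_map_map hUm.aemeasurable hVm.aemeasurable).1 hind]
    congr 1
    · exact map_precomp_eq_volume hX hu hi (S.orderEmbOfFin h).injective
    · exact map_precomp_eq_volume hX hu hi Subtype.val_injective
  have hset : {ω | Generates (fun i => X i ω) M k r S} =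
      (fun ω => (U ω, V ω)) ⁻¹' emptyBallPairs k d r J := by
    ext ω
    exact generates_iff h
  rw [hset, ← Measure.map_apply (hUm.prodMk hVm) (measurableSet_emptyBallPairs r J), hlaw,
    volume_emptyBallPairs hr, hJc]

lemma ae_injective [NeZero d] {X : ℕ → Ω → UnitAddTorus (Fin d)} (hX : ∀ i, Measurable (X i))
    (hu : ∀ i, μ.map (X i) = volume) (hi : iIndepFun X μ) :
    ∀ᵐ ω ∂μ, Function.Injective fun i => X i ω := by
  have h : ∀ i j, i ≠ j → ∀ᵐ ω ∂μ, X i ω ≠ X j ω := by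
    intro i j hij
    have hlaw : μ.map (fun ω => (X i ω, X j ω)) = volume.prod volume := by
      rw [(indepFun_iff_map_prod_eq_prod_map_map (hX i).aemeasurable (hX j).aemeasurable).1
        (hi.indepFun hij), hu, hu]
    have hm : MeasurableSet {p : UnitAddTorus (Fin d) × UnitAddTorus (Fin d) | p.1 = p.2} :=
      measurableSet_eq_fun measurable_fst measurable_snd
    rw [ae_iff]
    simp only [ne_eq, not_not]
    change μ ((fun ω => (X i ω, X j ω)) ⁻¹' {p | p.1 = p.2}) = 0
    rw [← Measure.map_apply ((hX i).prodMk (hX j)) hm, hlaw, Measure.measure_prod_null hm]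
    refine Filter.Eventually.of_forall fun x => ?_
    have : Prod.mk x ⁻¹' {p : UnitAddTorus (Fin d) × UnitAddTorus (Fin d) | p.1 = p.2} = {x} := by
      ext y; simp [eq_comm]
    change volume (Prod.mk x ⁻¹' {p | p.1 = p.2}) = 0
    rw [this, measure_singleton]
  have h' : ∀ᵐ ω ∂μ, ∀ i j, i ≠ j → X i ω ≠ X j ω := by
    simp only [ae_all_iff]
    exact h
  filter_upwards [h'] with ω hω i j hij
  by_contra hne
  exact hω i j hne hij

/-- The number of critical points of index `k` and of value at most `r` generated by `M` points in
general position. -/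
noncomputable def generatingCount (k d : ℕ) (r : ℝ) (M : ℕ) (x : ℕ → UnitAddTorus (Fin d)) :
    ℝ≥0∞ :=
  ∑ S ∈ (Finset.range M).powersetCard (k + 1),
    Set.indicator {x : ℕ → UnitAddTorus (Fin d) | Generates x M k r S} 1 x

lemma measurable_generatingCount (r : ℝ) (M : ℕ) : Measurable (generatingCount k d r M) := by
  unfold generatingCount
  exact Finset.measurable_fun_sum _ fun S hS =>
    measurable_one.indicator (measurableSet_generates M r (Finset.mem_powersetCard.1 hS).2)

lemma numCritical_eq_generatingCount {x : ℕ → UnitAddTorus (Fin d)}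
    (hx : Function.Injective x) {r : ℝ} (hr : r ≤ 1 / 6) (M : ℕ) :
    (numCritical {p | ∃ i < M, x i = p} k r : ℝ≥0∞) = generatingCount k d r M x := by
  classical
  rw [numCritical_eq_card hx.injOn hr, generatingCount, ENat.toENNReal_coe, Finset.card_filter,
    Nat.cast_sum]
  refine Finset.sum_congr rfl fun S _ => ?_
  rw [Set.indicator_apply]
  split_ifs <;> simp_all

lemma lintegral_generatingCount {X : ℕ → Ω → UnitAddTorus (Fin d)} (hX : ∀ i, Measurable (X i))
    (hu : ∀ i, μ.map (X i) = volume) (hi : iIndepFun X μ) {r : ℝ} (hr : r < 1 / 2) (M : ℕ) :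
    ∫⁻ ω, generatingCount k d r M (fun i => X i ω) ∂μ =
      (M.choose (k + 1) : ℝ≥0∞) * ∫⁻ t in centeredTuples k d r,
        ENNReal.ofReal (1 - unitBallVolume d * ‖zeroCenter (edgeLift t)‖ ^ d) ^ (M - (k + 1)) := by
  have hXm : Measurable (fun ω i => X i ω) := measurable_pi_iff.2 hX
  unfold generatingCount
  rw [lintegral_finsetSum']
  swap
  · exact fun S hS => ((measurable_one.indicator (measurableSet_generates M r
      (Finset.mem_powersetCard.1 hS).2)).comp hXm).aemeasurable
  rw [Finset.sum_congr rfl fun S hS => ?_, Finset.sum_const, Finset.card_powersetCard,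
    Finset.card_range, nsmul_eq_mul]
  rw [← measure_generates hX hu hi hr hS]
  exact lintegral_indicator_one
    (hXm (measurableSet_generates M r (Finset.mem_powersetCard.1 hS).2))

lemma hasSum_poisson_choose (n q : ℝ) (k : ℕ) :
    HasSum (fun M : ℕ => Real.exp (-n) * n ^ M / (M ! : ℝ) * (M.choose (k + 1) * q ^ (M - (k + 1))))
      (n ^ (k + 1) / ((k + 1)! : ℝ) * Real.exp (-(n * (1 - q)))) := by
  have h1 : HasSum (fun m : ℕ => (n * q) ^ m / (m ! : ℝ)) (Real.exp (n * q)) := by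
    rw [Real.exp_eq_exp_ℝ]
    exact NormedSpace.expSeries_div_hasSum_exp (n * q)
  have h2 := h1.mul_left (Real.exp (-n) * (n ^ (k + 1) / ((k + 1)! : ℝ)))
  have h3 : Real.exp (-n) * (n ^ (k + 1) / ((k + 1)! : ℝ)) * Real.exp (n * q) =
      n ^ (k + 1) / ((k + 1)! : ℝ) * Real.exp (-(n * (1 - q))) := by
    rw [show -(n * (1 - q)) = -n + n * q by ring, Real.exp_add]; ring
  rw [h3] at h2
  -- Terms with `M < k + 1` vanish; the shift `M = m + k + 1` leaves an exponential series in `n q`.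
  refine ((add_left_injective (k + 1)).hasSum_iff ?_).1 (h2.congr_fun ?_)
  · intro M hM
    rw [Nat.choose_eq_zero_of_lt]
    · simp
    · by_contra h
      exact hM ⟨M - (k + 1), Nat.sub_add_cancel (not_lt.1 h)⟩
  · intro m
    have := Nat.add_choose_mul_factorial_mul_factorial m (k + 1)
    simp only [Function.comp_apply, Nat.add_sub_cancel]
    have hc : ((m + (k + 1)).choose (k + 1) : ℝ) ≠ 0 :=
      Nat.cast_ne_zero.2 (Nat.choose_pos (Nat.le_add_left _ _)).ne'
    rw [← this]
    push_cast
    field_simp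
    ring

lemma lintegral_numCritical [NeZero d] {n : ℝ≥0} {N : Ω → ℕ}
    {X : ℕ → Ω → UnitAddTorus (Fin d)} (hP : IsPoissonData μ d n N X) {r : ℝ} (hr : r ≤ 1 / 6) :
    AEMeasurable (fun ω => (numCritical (poissonPoints N X ω) k r : ℝ≥0∞)) μ ∧
      ∫⁻ ω, (numCritical (poissonPoints N X ω) k r : ℝ≥0∞) ∂μ =
        ∫⁻ t in centeredTuples k d r, ENNReal.ofReal (n ^ (k + 1) / ((k + 1)! : ℝ) *
          Real.exp (-(n * (unitBallVolume d * ‖zeroCenter (edgeLift t)‖ ^ d)))) := by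
  obtain ⟨hX, hN, hu, hi, hpois, hind⟩ := hP
  have hXm : Measurable (fun ω i => X i ω) := measurable_pi_iff.2 hX
  have hNm : ∀ M, Measurable fun ω => Set.indicator {M} (1 : ℕ → ℝ≥0∞) (N ω) := fun M =>
    (measurable_one.indicator (measurableSet_singleton M)).comp hN
  have hGm : ∀ M, Measurable fun ω => generatingCount k d r M (fun i => X i ω) := fun M =>
    (measurable_generatingCount r M).comp hXm
  have hae : (fun ω => (numCritical (poissonPoints N X ω) k r : ℝ≥0∞)) =ᵐ[μ]
      fun ω => ∑' M, Set.indicator {M} (1 : ℕ → ℝ≥0∞) (N ω) *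
        generatingCount k d r M (fun i => X i ω) := by
    filter_upwards [ae_injective hX hu hi] with ω hω
    -- Splitting over the value of `N` makes each summand a product of independent factors; at `ω`
    -- only `M = N ω` survives.
    rw [tsum_eq_single (N ω) fun M hM => by simp [hM.symm]]
    simpa [poissonPoints] using numCritical_eq_generatingCount hω hr (N ω)
  have hmeas : Measurable fun ω => ∑' M, Set.indicator {M} (1 : ℕ → ℝ≥0∞) (N ω) *
        generatingCount k d r M (fun i => X i ω) :=
    Measurable.tsum fun M => (hNm M).mul (hGm M)
  refine ⟨⟨_, hmeas, hae⟩, ?_⟩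
  rw [lintegral_congr_ae hae, lintegral_tsum (f := fun M ω =>
    Set.indicator {M} (1 : ℕ → ℝ≥0∞) (N ω) * generatingCount k d r M (fun i => X i ω)) fun M => ((hNm M).mul (hGm M)).aemeasurable]
  have hterm : ∀ M, ∫⁻ ω, Set.indicator {M} (1 : ℕ → ℝ≥0∞) (N ω) *
        generatingCount k d r M (fun i => X i ω) ∂μ =
      ∫⁻ t in centeredTuples k d r, ENNReal.ofReal (Real.exp (-n) * n ^ M / (M ! : ℝ) *
        (M.choose (k + 1) * (1 - unitBallVolume d * ‖zeroCenter (edgeLift t)‖ ^ d) ^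
          (M - (k + 1)))) := by
    intro M
    have h1 := lintegral_mul_eq_lintegral_mul_lintegral_of_indepFun (hNm M) (hGm M)
      (hind.comp (measurable_one.indicator (measurableSet_singleton M))
        (measurable_generatingCount r M))
    have h2 : ∫⁻ ω, Set.indicator {M} (1 : ℕ → ℝ≥0∞) (N ω) ∂μ =
        ENNReal.ofReal (Real.exp (-n) * n ^ M / (M ! : ℝ)) := by
      rw [← lintegral_map (measurable_one.indicator (measurableSet_singleton M)) hN, hpois,
        lintegral_indicator_one (measurableSet_singleton M), poissonMeasure_singleton]
    refine h1.trans ?_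
    rw [h2, lintegral_generatingCount hX hu hi (by linarith), ← mul_assoc,
      ← lintegral_const_mul _ (by fun_prop)]
    refine setLIntegral_congr_fun (measurableSet_centeredTuples r) fun t ht => ?_
    -- Nonnegativity is needed because `ENNReal.ofReal` truncates negative numbers and commutes with
    -- powers only for nonnegative bases.
    have hq : 0 ≤ 1 - unitBallVolume d * ‖zeroCenter (edgeLift t)‖ ^ d :=
      sub_nonneg.2 (unitBallVolume_mul_pow_le_one d (norm_nonneg _) (by linarith [ht.2]))
    rw [ENNReal.ofReal_mul (by positivity), ENNReal.ofReal_mul (by positivity),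
      ENNReal.ofReal_natCast, ENNReal.ofReal_pow hq, mul_assoc]
  simp_rw [hterm]
  rw [← lintegral_tsum fun M => by fun_prop]
  refine setLIntegral_congr_fun (measurableSet_centeredTuples r) fun t ht => ?_
  have hq : 0 ≤ 1 - unitBallVolume d * ‖zeroCenter (edgeLift t)‖ ^ d :=
    sub_nonneg.2 (unitBallVolume_mul_pow_le_one d (norm_nonneg _) (by linarith [ht.2]))
  have hs := hasSum_poisson_choose n (1 - unitBallVolume d * ‖zeroCenter (edgeLift t)‖ ^ d) k
  rw [← ENNReal.ofReal_tsum_of_nonneg (fun M => by positivity) hs.summable, hs.tsum_eq,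
    sub_sub_cancel]

end Poisson

/-! ### Reduction to Euclidean space and scaling -/

/-- Subtracting `t 0` from the other points is a shear that preserves Haar measure; the base point,
of total mass one, is then projected away. -/
lemma measurePreserving_edgeLift :
    MeasurePreserving (edgeLift (k := k) (d := d)) volume
      (volume.restrict (Set.univ.pi fun _ => unitCube d)) := by
  have h1 := volume_preserving_piFinSuccAbove (fun _ : Fin (k + 1) => UnitAddTorus (Fin d)) 0
  have h2 : MeasurePreserving (fun p : UnitAddTorus (Fin d) × (Fin k → UnitAddTorus (Fin d)) =>
      (p.1, fun i => p.2 i - p.1)) (volume.prod volume) (volume.prod volume) := by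
    refine (MeasurePreserving.id _).skew_product
      (g := fun a (z : Fin k → UnitAddTorus (Fin d)) i => z i - a) (by fun_prop) ?_
    refine Filter.Eventually.of_forall fun a => ?_
    exact (measurePreserving_pi (fun _ : Fin k => (volume : Measure (UnitAddTorus (Fin d))))
      (fun _ => volume) fun _ => measurePreserving_sub_right volume a).map_eq
  have h3 := measurePreserving_pi (fun _ : Fin k => (volume : Measure (UnitAddTorus (Fin d))))
    (fun _ => volume.restrict (unitCube d)) fun _ => ⟨measurable_torusLift, map_torusLift⟩
  rw [← Measure.restrict_pi_pi] at h3
  exact h3.comp (measurePreserving_snd.comp (h2.comp h1))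

/-- The tuples `y` of vectors with `h(0, y) = 1` and `R(0, y) ≤ r`. -/
def centeredVectors (k d : ℕ) (r : ℝ) : Set (Fin k → EuclideanSpace ℝ (Fin d)) :=
  {y | CenterInSimplex (withZero y) ∧ ‖zeroCenter y‖ ≤ r}

lemma measurableSet_centeredVectors (r : ℝ) : MeasurableSet (centeredVectors k d r) :=
  measurableSet_centerInSimplex.inter
    (measurableSet_le (f := fun y => ‖zeroCenter y‖) (by fun_prop) measurable_const)

lemma lintegral_centeredTuples {r : ℝ} (hr : r ≤ 1 / 6) {g : ℝ → ℝ≥0∞} (hg : Measurable g) :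
    ∫⁻ t in centeredTuples k d r, g ‖zeroCenter (edgeLift t)‖ =
      ∫⁻ y in centeredVectors k d r, g ‖zeroCenter y‖ := by
  have hpre : centeredTuples k d r = edgeLift ⁻¹' centeredVectors k d r := rfl
  have hsub : centeredVectors k d r ⊆ Set.univ.pi fun _ => unitCube d := by
    intro y hy i _
    exact mem_unitCube_of_norm_lt ((hy.1.norm_le i).trans_lt (by linarith [hy.2]))
  rw [hpre, (measurePreserving_edgeLift.restrict_preimage
    (measurableSet_centeredVectors r)).lintegral_comp (f := fun y => g ‖zeroCenter y‖)
    (by fun_prop), Measure.restrict_restrict (measurableSet_centeredVectors r),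
    Set.inter_eq_left.2 hsub]

open scoped Pointwise in
lemma centeredVectors_eq_smul {τ : ℝ} (hτ : 0 < τ) :
    centeredVectors k d τ = τ • centeredVectors k d 1 := by
  ext y
  rw [Set.mem_smul_set_iff_inv_smul_mem₀ hτ.ne']
  simp only [centeredVectors, Set.mem_ofPred_eq]
  rw [centerInSimplex_smul_iff (inv_ne_zero hτ.ne')]
  refine and_congr_right fun hy => ?_
  rw [zeroCenter_smul (inv_ne_zero hτ.ne') hy.linearIndependent, norm_smul, norm_inv,
    Real.norm_of_nonneg hτ.le, inv_mul_le_one₀ hτ]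

lemma centeredVectors_eq_empty [NeZero k] {τ : ℝ} (hτ : τ ≤ 0) : centeredVectors k d τ = ∅ := by
  refine Set.eq_empty_of_forall_notMem fun y hy => ?_
  exact zeroCenter_ne_zero hy.1.linearIndependent (norm_le_zero_iff.1 (hy.2.trans hτ))

lemma volume_centeredVectors [NeZero k] [NeZero d] {τ : ℝ} (hτ : 0 ≤ τ) :
    volume (centeredVectors k d τ) =
      volume (centeredVectors k d 1) * ENNReal.ofReal (τ ^ (d * k)) := by
  rcases hτ.eq_or_lt with rfl | hτ
  · rw [centeredVectors_eq_empty le_rfl, measure_empty,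
      zero_pow (mul_ne_zero (NeZero.ne d) (NeZero.ne k)), ENNReal.ofReal_zero, mul_zero]
  · have hfin : Module.finrank ℝ (Fin k → EuclideanSpace ℝ (Fin d)) = d * k := by
      simp [Module.finrank_pi_fintype, mul_comm]
    rw [centeredVectors_eq_smul hτ, Measure.addHaar_smul, hfin, abs_of_nonneg (by positivity),
      mul_comm]

lemma volume_centeredVectors_one_lt_top : volume (centeredVectors k d 1) < ⊤ := by
  refine (measure_mono fun y hy => ?_).trans_lt
    (measure_closedBall_lt_top (x := (0 : Fin k → EuclideanSpace ℝ (Fin d))) (r := 2))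
  rw [mem_closedBall_zero_iff, pi_norm_le_iff_of_nonneg (by norm_num)]
  exact fun i => (hy.1.norm_le i).trans (by linarith [hy.2])

lemma setLIntegral_Ioc_ofReal_deriv {F f : ℝ → ℝ} (hF : ∀ x, HasDerivAt F (f x) x)
    (hf : Continuous f) {b : ℝ} (hb : 0 ≤ b) (hpos : ∀ x ∈ Set.Ioc 0 b, 0 ≤ f x) :
    ∫⁻ x in Set.Ioc 0 b, ENNReal.ofReal (f x) = ENNReal.ofReal (F b - F 0) := by
  rw [← intervalIntegral.integral_eq_sub_of_hasDerivAt (fun x _ => hF x)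
    (hf.intervalIntegrable 0 b), intervalIntegral.integral_of_le hb,
    ofReal_integral_eq_lintegral_ofReal]
  · exact (hf.intervalIntegrable 0 b).1
  · exact (ae_restrict_iff' measurableSet_Ioc).2 (Filter.Eventually.of_forall hpos)

/-- Integration in spherical coordinates for `R`. Both measures are determined by their values on
half-lines, where scaling in dimension `d k` gives multiples of `τ^(dk)`. -/
lemma map_norm_zeroCenter [NeZero k] [NeZero d] (r : ℝ) :
    (volume.restrict (centeredVectors k d r)).map (fun y => ‖zeroCenter y‖) =
      (volume.restrict (Set.Ioc 0 r)).withDensity fun τ =>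
        volume (centeredVectors k d 1) *
          ENNReal.ofReal ((d * k : ℕ) * τ ^ (d * k - 1)) := by
  have hfin : IsFiniteMeasure ((volume.restrict (centeredVectors k d r)).map
      (fun y => ‖zeroCenter y‖)) := by
    have : IsFiniteMeasure (volume.restrict (centeredVectors k d r)) := by
      refine ⟨?_⟩
      rw [Measure.restrict_apply_univ]
      rcases le_total 0 r with h | h
      · rw [volume_centeredVectors h]
        exact ENNReal.mul_lt_top volume_centeredVectors_one_lt_top ENNReal.ofReal_lt_top
      · rw [centeredVectors_eq_empty h, measure_empty]
        exact ENNReal.zero_lt_top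
    infer_instance
  refine Measure.ext_of_Iic _ _ fun a => ?_
  have h1 : (fun y : Fin k → EuclideanSpace ℝ (Fin d) => ‖zeroCenter y‖) ⁻¹' Set.Iic a ∩
      centeredVectors k d r = centeredVectors k d (min a r) := by
    ext y
    simp only [centeredVectors, Set.mem_inter_iff, Set.mem_preimage, Set.mem_Iic,
      Set.mem_ofPred_eq, le_min_iff]
    tauto
  rw [Measure.map_apply (by fun_prop) measurableSet_Iic,
    Measure.restrict_apply (measurableSet_Iic.preimage (by fun_prop)), h1,
    withDensity_apply _ measurableSet_Iic, Measure.restrict_restrict measurableSet_Iic,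
    Set.inter_comm, Set.Ioc_inter_Iic, min_comm, lintegral_const_mul _ (by fun_prop)]
  rcases le_total 0 (min r a) with h | h
  · rw [setLIntegral_Ioc_ofReal_deriv (F := fun τ => τ ^ (d * k)) (fun x => hasDerivAt_pow _ x)
      (by fun_prop) h fun x hx => mul_nonneg (Nat.cast_nonneg _) (pow_nonneg hx.1.le _),
      volume_centeredVectors h, zero_pow (mul_ne_zero (NeZero.ne d) (NeZero.ne k)), sub_zero]
  · rw [centeredVectors_eq_empty h, Set.Ioc_eq_empty (not_lt.2 h)]
    simp

/-! ### The radial integral and the constant -/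

/-- Differentiating the partial exponential sum drops its last term, so everything else cancels. -/
lemma hasDerivAt_exp_neg_mul_sum (k : ℕ) (x : ℝ) :
    HasDerivAt (fun x => Real.exp (-x) * ∑ j ∈ Finset.range (k + 1), x ^ j / (j ! : ℝ))
      (-(Real.exp (-x) * x ^ k / (k ! : ℝ))) x := by
  have he : HasDerivAt (fun x => Real.exp (-x)) (-Real.exp (-x)) x := by
    simpa using (hasDerivAt_neg x).exp
  induction k with
  | zero => simpa using he
  | succ k ih =>
    have h := ih.add (he.mul ((hasDerivAt_pow (k + 1) x).div_const ((k + 1)! : ℝ)))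
    refine (h.congr_deriv ?_).congr_of_eventuallyEq (Filter.Eventually.of_forall fun x => ?_)
    · rw [Nat.add_sub_cancel, Nat.factorial_succ]
      push_cast
      field_simp
      ring
    · simp only [Pi.add_apply, Pi.mul_apply]
      rw [Finset.sum_range_succ _ (k + 1)]
      ring

lemma unitBallVolume_pos (d : ℕ) : 0 < unitBallVolume d :=
  ENNReal.toReal_pos (Metric.measure_ball_pos volume _ one_pos).ne' measure_ball_lt_top.ne

lemma hasDerivAt_bigLambda (n τ : ℝ) (d : ℕ) :
    HasDerivAt (fun τ => bigLambda d n τ) (unitBallVolume d * n * (d * τ ^ (d - 1))) τ :=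
  (hasDerivAt_pow d τ).const_mul _

lemma bigLambda_zero [NeZero d] (n : ℝ) : bigLambda d n 0 = 0 := by
  rw [bigLambda, zero_pow (NeZero.ne d), mul_zero]

lemma lintegral_centeredVectors [NeZero k] [NeZero d] (n : ℝ≥0) {r : ℝ} (hr : 0 ≤ r) :
    ∫⁻ y in centeredVectors k d r, ENNReal.ofReal (n ^ (k + 1) / ((k + 1)! : ℝ) *
        Real.exp (-(n * (unitBallVolume d * ‖zeroCenter y‖ ^ d)))) =
      volume (centeredVectors k d 1) *
        ENNReal.ofReal (n * (k * (k - 1)!) / (unitBallVolume d ^ k * ((k + 1)! : ℝ)) *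
          (1 - Real.exp (-bigLambda d n r) *
            ∑ j ∈ Finset.range k, bigLambda d n r ^ j / (j ! : ℝ))) := by
  obtain ⟨l, rfl⟩ := Nat.exists_eq_succ_of_ne_zero (NeZero.ne k)
  obtain ⟨e, rfl⟩ := Nat.exists_eq_succ_of_ne_zero (NeZero.ne d)
  simp only [Nat.succ_eq_add_one] at *
  set ω := unitBallVolume (e + 1) with hω
  have hωpos : 0 < ω := unitBallVolume_pos _
  rw [← lintegral_map (μ := volume.restrict (centeredVectors (l + 1) (e + 1) r))
    (g := fun y => ‖zeroCenter y‖)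
    (f := fun τ => ENNReal.ofReal (n ^ (l + 1 + 1) / ((l + 1 + 1)! : ℝ) *
      Real.exp (-(n * (ω * τ ^ (e + 1)))))) (by fun_prop) (by fun_prop),
    map_norm_zeroCenter, lintegral_withDensity_eq_lintegral_mul _ (by fun_prop) (by fun_prop)]
  simp only [Pi.mul_apply, mul_assoc (volume (centeredVectors (l + 1) (e + 1) 1))]
  rw [lintegral_const_mul _ (by fun_prop)]
  congr 1
  -- With `k = l + 1`, `C` is the factor for which `-C * G(Λ(τ))` differentiates to the radial
  -- integrand; the chain rule supplies `(n ω)^(l+1)`, which accounts for the powers of `n` and `ω`.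
  set C : ℝ := n * ((l + 1 : ℕ) * (l + 1 - 1)!) / (ω ^ (l + 1) * ((l + 1 + 1)! : ℝ)) with hC
  set G : ℝ → ℝ := fun x => Real.exp (-x) * ∑ j ∈ Finset.range (l + 1), x ^ j / (j ! : ℝ) with hG
  have hderiv : ∀ τ, HasDerivAt (fun τ => -C * G (bigLambda (e + 1) n τ))
      ((((e + 1) * (l + 1) : ℕ) * τ ^ ((e + 1) * (l + 1) - 1)) *
        (n ^ (l + 1 + 1) / ((l + 1 + 1)! : ℝ) * Real.exp (-(n * (ω * τ ^ (e + 1)))))) τ := by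
    intro τ
    refine (((hasDerivAt_exp_neg_mul_sum l _).comp τ
      (hasDerivAt_bigLambda n τ (e + 1))).const_mul (-C)).congr_deriv ?_
    have h1 : (e + 1) * (l + 1) - 1 = (e + 1) * l + e := by
      rw [Nat.mul_succ, ← Nat.add_assoc, Nat.add_sub_cancel]
    have h2 : -bigLambda (e + 1) n τ = -(n * (ω * τ ^ (e + 1))) := by
      rw [bigLambda, ← hω]; ring
    rw [h2, h1, hC, bigLambda, ← hω, Nat.add_sub_cancel, Nat.add_sub_cancel]
    push_cast
    field_simp
    ring
  have hpos : ∀ τ ∈ Set.Ioc 0 r, 0 ≤ (((e + 1) * (l + 1) : ℕ) * τ ^ ((e + 1) * (l + 1) - 1)) *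
        (n ^ (l + 1 + 1) / ((l + 1 + 1)! : ℝ) * Real.exp (-(n * (ω * τ ^ (e + 1))))) := by
    intro τ hτ
    have := hτ.1.le
    positivity
  have hmul : ∀ τ ∈ Set.Ioc 0 r,
      ENNReal.ofReal (((e + 1) * (l + 1) : ℕ) * τ ^ ((e + 1) * (l + 1) - 1)) *
        ENNReal.ofReal (n ^ (l + 1 + 1) / ((l + 1 + 1)! : ℝ) *
          Real.exp (-(n * (ω * τ ^ (e + 1))))) =
      ENNReal.ofReal ((((e + 1) * (l + 1) : ℕ) * τ ^ ((e + 1) * (l + 1) - 1)) *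
        (n ^ (l + 1 + 1) / ((l + 1 + 1)! : ℝ) * Real.exp (-(n * (ω * τ ^ (e + 1)))))) := by
    intro τ hτ
    have := hτ.1.le
    exact (ENNReal.ofReal_mul (by positivity)).symm
  rw [setLIntegral_congr_fun measurableSet_Ioc hmul,
    setLIntegral_Ioc_ofReal_deriv hderiv (by fun_prop) hr hpos]
  have hG0 : G (bigLambda (e + 1) n 0) = 1 := by
    simp [hG, bigLambda_zero, Finset.sum_range_succ']
  rw [hG0]
  congr 1
  simp only [hG]
  ring

/-- Normalising to `R = 1` does not change `h`, so the preimage of `{h = 1}` in `{R ≤ 1}` is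
`centeredVectors k d 1`. -/
lemma angularMeasure_centerInSimplex [NeZero k] :
    angularMeasure k d {u | CenterInSimplex (withZero u)} =
      ((d * k : ℕ) : ℝ≥0∞) * volume (centeredVectors k d 1) := by
  have hB : {y : Fin k → EuclideanSpace ℝ (Fin d) |
      AffineIndependent ℝ (withZero y) ∧ tupleRadius (withZero y) ≤ 1} =
      {y | LinearIndependent ℝ y} ∩ {y | ‖zeroCenter y‖ ≤ 1} := by
    ext y
    simp only [Set.mem_ofPred_eq, Set.mem_inter_iff]
    rw [← affineIndependent_withZero_iff]
    exact and_congr_right fun hy => by rw [tupleRadius_withZero hy]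
  have hBm : MeasurableSet ({y : Fin k → EuclideanSpace ℝ (Fin d) | LinearIndependent ℝ y} ∩
      {y | ‖zeroCenter y‖ ≤ 1}) :=
    measurableSet_linearIndependent.inter
      (measurableSet_le (f := fun y => ‖zeroCenter y‖) (by fun_prop) measurable_const)
  have hmap : (fun y : Fin k → EuclideanSpace ℝ (Fin d) => (tupleRadius (withZero y))⁻¹ • y)
      =ᵐ[volume.restrict ({y | LinearIndependent ℝ y} ∩ {y | ‖zeroCenter y‖ ≤ 1})]
      fun y => ‖zeroCenter y‖⁻¹ • y := by
    filter_upwards [ae_restrict_mem hBm] with y hy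
    rw [tupleRadius_withZero ((affineIndependent_withZero_iff y).2 hy.1)]
  rw [angularMeasure, hB, Measure.map_congr hmap, Measure.smul_apply, smul_eq_mul,
    Measure.map_apply (by fun_prop) measurableSet_centerInSimplex,
    Measure.restrict_apply (measurableSet_centerInSimplex.preimage (by fun_prop))]
  congr 2
  ext y
  simp only [centeredVectors, Set.mem_ofPred_eq, Set.mem_inter_iff, Set.mem_preimage]
  constructor
  · rintro ⟨h1, h2, h3⟩
    exact ⟨(centerInSimplex_smul_iff
      (inv_ne_zero (norm_ne_zero_iff.2 (zeroCenter_ne_zero h2))) y).1 h1, h3⟩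
  · rintro ⟨h1, h3⟩
    exact ⟨(centerInSimplex_smul_iff (inv_ne_zero (norm_ne_zero_iff.2
      (zeroCenter_ne_zero h1.linearIndependent))) y).2 h1, h1.linearIndependent, h3⟩

lemma critConst_eq [NeZero k] [NeZero d] : critConst k d =
    volume.real (centeredVectors k d 1) *
      ((k * (k - 1)!) / (unitBallVolume d ^ k * ((k + 1)! : ℝ))) := by
  have hd : (d : ℝ) ≠ 0 := Nat.cast_ne_zero.2 (NeZero.ne d)
  rw [critConst, tildeConst, Measure.real, angularMeasure_centerInSimplex, ENNReal.toReal_mul,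
    ENNReal.toReal_natCast, ← Measure.real]
  push_cast
  field_simp

theorem proposition6p1 {Ω : Type*} [MeasurableSpace Ω] (μ : Measure Ω) [IsProbabilityMeasure μ]
    (d k : ℕ) (hk : 1 ≤ k) (hkd : k ≤ d) (n : ℝ≥0)
    (N : Ω → ℕ) (X : ℕ → Ω → UnitAddTorus (Fin d)) (hP : IsPoissonData μ d n N X)
    (r : ℝ) (hr0 : 0 ≤ r) (hr : r ≤ rMax) :
    AEMeasurable (fun ω => (numCritical (poissonPoints N X ω) k r : ℝ≥0∞)) μ ∧
      ∫⁻ ω, (numCritical (poissonPoints N X ω) k r : ℝ≥0∞) ∂μ =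
        ENNReal.ofReal (critConst k d * n *
          (1 - Real.exp (-bigLambda d n r) *
            ∑ j ∈ Finset.range k, bigLambda d n r ^ j / (j ! : ℝ))) := by
  have : NeZero k := ⟨by omega⟩
  have : NeZero d := ⟨by omega⟩
  have hr6 : r ≤ 1 / 6 := by rw [rMax] at hr; linarith
  refine ⟨(lintegral_numCritical hP hr6).1, ?_⟩
  rw [(lintegral_numCritical hP hr6).2, lintegral_centeredTuples hr6
    (g := fun ρ => ENNReal.ofReal (n ^ (k + 1) / ((k + 1)! : ℝ) *
      Real.exp (-(n * (unitBallVolume d * ρ ^ d))))) (by fun_prop),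
    lintegral_centeredVectors n hr0, critConst_eq,
    ← ENNReal.ofReal_toReal volume_centeredVectors_one_lt_top.ne, ← Measure.real,
    ← ENNReal.ofReal_mul measureReal_nonneg]
  congr 1
  ring
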